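/- For each $i$ in an index set $I$ let $q_i$ and $t_i$ be powers of $2$, let $n_i=t_i^2-1\ge 1$ and let $m_i$ be a positive multiple of $n_i$. Let $\sigma_i$ be a generator of $\mathrm{Gal}(\mathbb F_{q_i^{m_i}}/\mathbb F_{q_i})$, and let $\mathcal C_i$ be a rank-metric code of $\sigma_i$-linearized polynomials over $\mathbb F_{q_i^{m_i}}$, that is, a set of $\mathbb F_{q_i}$-linear endomorphisms of $\mathbb F_{q_i^{m_i}}$. Let $\mathrm C_i=\{(g(\alpha_1),\dots,g(\alpha_{n_i})) : g\in\mathcal C_i\}\subseteq \mathbb F_{q_i^{m_i}}^{n_i}$ be its evaluation code over an $\mathbb F_{q_i}$-basis $\alpha_1,\dots,\alpha_{n_i}$ of $\beta_i\mathbb F_{q_i^{n_i}}$, where $\beta_i\in\mathbb F_{q_i^{m_i}}^*$, and let $d_i$ be the minimum distance of $\mathrm C_i$ with respect to the rank distance $d(\mathbf u,\mathbf v)=\mathrm{rk}(\mathbf u-\mathbf v)$, where $\mathrm{rk}(\mathbf v)=\dim_{\mathbb F_{q_i}}\langle v_1,\dots,v_{n_i}\rangle_{\mathbb F_{q_i}}$.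 Suppose that for every $i$: 1. $n_i-d_i+1\le t_i\le n_i-\lfloor (d_i-1)/2\rfloor-1$; 2. $\mathcal C_i$ contains $(\mathcal G_{n_i,2,\sigma_i})^{\sigma_i^{j_i}}=\{(a_0x+a_1x^{\sigma_i})^{\sigma_i^{j_i}} : a_0,a_1\in\mathbb F_{q_i^{n_i}}\}$ for some integer $j_i$ with $0\le j_i<n_i-t_i$. Suppose that the lengths $n_i$ are unbounded. Then the family $(\mathrm C_i)_{i\in I}$ is not efficiently list decodable at any radii $\tau_i\ge n_i-t_i$. That is, there is no polynomial-time list decoding algorithm: no Turing machine, even if it is given an arbitrary string of advice on the code $\mathrm C_i$ and an arbitrary injective representation of the elements of $\mathbb F_{q_i^{m_i}}$ by bit strings, outputs, for every $i$ and every received word $\mathbf w\in\mathbb F_{q_i^{m_i}}^{n_i}$, a list, written out codeword by codeword, of all $\mathbf c\in \mathrm C_i$ with $\mathrm{rk}(\mathbf w-\mathbf c)\le\tau_i$ within a number of steps bounded by a polynomial in the length $n_i$. -/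

import Mathlib

/-! ### Rank-metric codes -/

namespace RankMetric

/-- The rank weight of `v ∈ Kⁿ` over `F`: the `F`-dimension of the span of its entries. -/
noncomputable def rankWeight (F : Type*) {K : Type*} [Field F] [Field K] [Algebra F K] {n : ℕ}
    (v : Fin n → K) : ℕ :=
  Module.finrank F (Submodule.span F (Set.range v))

/-- The rank distance. -/
noncomputable def rankDist (F : Type*) {K : Type*} [Field F] [Field K] [Algebra F K] {n : ℕ}
    (u v : Fin n → K) : ℕ :=
  rankWeight F (u - v)

/-- The ball `B_τ(w)` in the rank metric. -/
def ball (F : Type*) {K : Type*} [Field F] [Field K] [Algebra F K] {n : ℕ}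
    (τ : ℕ) (w : Fin n → K) : Set (Fin n → K) :=
  {c | rankDist F w c ≤ τ}

/-- `d` is the minimum distance of the code `C`: the least distance of two distinct codewords. -/
def IsMinDist (F : Type*) {K : Type*} [Field F] [Field K] [Algebra F K] {n : ℕ}
    (C : Set (Fin n → K)) (d : ℕ) : Prop :=
  IsLeast {r | ∃ u ∈ C, ∃ v ∈ C, u ≠ v ∧ r = rankDist F u v} d

/-- The `σ`-polynomial `∑_{i<k} a_i x^{σ^i}`, as an `F`-linear endomorphism of `K`. -/
def sigmaPoly {F K : Type*} [Field F] [Field K] [Algebra F K] (σ : K ≃ₐ[F] K) {k : ℕ}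
    (a : Fin k → K) : K →ₗ[F] K :=
  ∑ i : Fin k, a i • (σ ^ (i : ℕ)).toLinearMap

/-- The generalized Gabidulin code
`{a₀ x + a₁ x^σ + ⋯ + a_{k-1} x^{σ^{k-1}} : a_i ∈ E}` with coefficients in the subfield `E` of `K`,
seen among the endomorphisms of `K`. For `E = 𝔽_{q^n}` this is `𝒢_{n,k,σ}`. -/
def gabidulin {F K : Type*} [Field F] [Field K] [Algebra F K] (σ : K ≃ₐ[F] K)
    (E : IntermediateField F K) (k : ℕ) : Set (K →ₗ[F] K) :=
  {f | ∃ a : Fin k → K, (∀ i, a i ∈ E) ∧ f = sigmaPoly σ a}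

/-- `𝒢^{σ^j} = {f(x)^{σ^j} : f ∈ 𝒢}`. -/
def sigmaPower {F K : Type*} [Field F] [Field K] [Algebra F K] (σ : K ≃ₐ[F] K) (j : ℕ)
    (G : Set (K →ₗ[F] K)) : Set (K →ₗ[F] K) :=
  (fun f => (σ ^ j).toLinearMap ∘ₗ f) '' G

/-- The evaluation code `{(g(α₁), …, g(αₙ)) : g ∈ 𝒞}`. -/
def evalCode {F K : Type*} [Field F] [Field K] [Algebra F K] {n : ℕ}
    (𝒞 : Set (K →ₗ[F] K)) (α : Fin n → K) : Set (Fin n → K) :=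
  (fun g l => g (α l)) '' 𝒞

/-- `α₁, …, αₙ` is an `F`-basis of the `F`-subspace `β E` of `K`. -/
def IsBasisOfMul {F K : Type*} [Field F] [Field K] [Algebra F K] {n : ℕ}
    (β : K) (E : IntermediateField F K) (α : Fin n → K) : Prop :=
  LinearIndependent F α ∧ (Submodule.span F (Set.range α) : Set K) = {y | ∃ x ∈ E, y = β * x}

/-! ### Turing machines with running time -/

/-- The symbols machines read and write: bits and two separators. -/
inductive Symb where
  | bit (b : Bool)
  | comma
  | semicolon

/-- A deterministic Turing machine with finitely many states and `extra + 1` two-way infinite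
tapes over the alphabet `Symb` with a blank (`none`), and a write-only output tape. Given the state
and the scanned symbols, it halts (`none`), or it goes to a new state, on each tape writes a symbol
and then moves the head one cell or lets it stay, and appends at most one symbol to the output. -/
structure Machine where
  State : Type
  finite_state : Finite State
  extra : ℕ
  start : State
  trans : State → (Fin (extra + 1) → Option Symb) →
    Option (State × (Fin (extra + 1) → Option Symb × Option Turing.Dir) × Option Symb)

namespace Machine

/-- Configurations: the state, the contents of the tapes with the head positions, and what has
been written to the output tape. -/
structure Config (M : Machine) where
  state : M.State
  tapes : Fin (M.extra + 1) → Turing.Tape (Option Symb)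
  output : List Symb

/-- Move the head of a tape, or let it stay. -/
def moveHead (T : Turing.Tape (Option Symb)) : Option Turing.Dir → Turing.Tape (Option Symb)
  | none => T
  | some D => T.move D

/-- One step; `none` if the machine has halted. -/
def step (M : Machine) (c : M.Config) : Option M.Config :=
  (M.trans c.state (fun k => (c.tapes k).head)).map fun r =>
    { state := r.1
      tapes := fun k => moveHead ((c.tapes k).write (r.2.1 k).1) (r.2.1 k).2
      output := c.output ++ r.2.2.toList }

/-- The initial configuration: the input on tape `0`, its first symbol being scanned, the other
tapes blank, nothing written to the output tape. -/
def init (M : Machine) (input : List Symb) : M.Config where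
  state := M.start
  tapes := fun k => Turing.Tape.mk₁ (if k = 0 then input.map some else [])
  output := []

/-- The configuration after `T` steps (a halted machine stays where it is). -/
def run (M : Machine) (input : List Symb) (T : ℕ) : M.Config :=
  (fun c => (M.step c).getD c)^[T] (M.init input)

/-- On the given input, `M` halts after at most `T` steps, and then its output is `out`. -/
def OutputsWithin (M : Machine) (input out : List Symb) (T : ℕ) : Prop :=
  M.step (M.run input T) = none ∧ (M.run input T).output = out

end Machine

/-! ### Efficient list decoding -/

/-- A word of `Kⁿ`, written entry by entry, given a representation `enc` of the elements of `K`
by bit strings. -/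
def encodeWord {K : Type*} (enc : K → List Bool) {n : ℕ} (w : Fin n → K) : List Symb :=
  (List.ofFn w).flatMap fun x => (enc x).map Symb.bit ++ [Symb.comma]

/-- A list of words, written word by word. -/
def encodeList {K : Type*} (enc : K → List Bool) {n : ℕ} (L : List (Fin n → K)) : List Symb :=
  L.flatMap fun c => encodeWord enc c ++ [Symb.semicolon]

/-- What the decoder receives: a description of the code, and the received word. -/
def encodeInput {K : Type*} (desc : List Bool) (enc : K → List Bool) {n : ℕ} (w : Fin n → K) :
    List Symb :=
  desc.map Symb.bit ++ [Symb.semicolon] ++ encodeWord enc w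

/-- A family of codes `C i ⊆ (K i)^(n i)` is efficiently list decodable at the radii `τ i` if it
has a polynomial-time list decoding algorithm: a Turing machine which, for every code of the family
and every received word `w`, lists all codewords in the ball `B_τ(w)`, in a number of steps which
is bounded by a polynomial in the length of the code. How field elements are represented by bit
strings may be chosen to suit the algorithm, and so may the string that tells the machine which of
the codes is used; that string may carry any information on the code. -/
def EfficientlyListDecodable {ι : Type*} (F : ι → Type*) {K : ι → Type*}
    [∀ i, Field (F i)] [∀ i, Field (K i)] [∀ i, Algebra (F i) (K i)]
    {n : ι → ℕ} (C : ∀ i, Set (Fin (n i) → K i)) (τ : ι → ℕ) : Prop :=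
  ∃ (M : Machine) (desc : ι → List Bool) (enc : ∀ i, K i → List Bool) (p : Polynomial ℕ),
    (∀ i, Function.Injective (enc i)) ∧
    ∀ (i : ι) (w : Fin (n i) → K i), ∃ L : List (Fin (n i) → K i),
      (∀ c, c ∈ L ↔ c ∈ C i ∩ ball (F i) (τ i) w) ∧
      M.OutputsWithin (encodeInput (desc i) (enc i) w) (encodeList (enc i) L) (p.eval (n i))

end RankMetric

/-! The obstruction is output length: some ball holds superpolynomially many codewords, and a
machine writes at most one symbol per step. Since `n = (t - 1)(t + 1)`, the field `𝔽_{q^n}` contains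
`L = 𝔽_{q^{t-1}}` and has an `L`-basis `b` of size `t + 1`. Let `w` apply Frobenius to the
coordinates in this basis. For `x ≠ 0` in `L`, `w` agrees with multiplication by `x^{q-1}` on the
`F`-span of the `x b_k`, so their difference has rank at most `n - t - 1`. There are at least
`q^{t-2}` distinct such multipliers (`exists_linearMap_many_multipliers`). Each multiplication is a
Gabidulin polynomial with `a₁ = 0`, so `exists_ball_many_codewords` turns these maps into codewords
near one received word. Finally `2^{t-2}` outgrows every polynomial in `n = t² - 1`. -/

namespace RankMetric

/-! ### Linear maps agreeing with many multiplications -/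

section Multipliers

variable {F L E : Type*} [Field F] [Field L] [Field E] [Algebra F L] [Algebra L E] [Algebra F E]
  [IsScalarTower F L E]

/-- The `F`-linear map `∑ xᵢ bᵢ ↦ ∑ φ(xᵢ) bᵢ` that acts through `φ` on the coordinates with
respect to an `L`-basis `b`. -/
noncomputable def coordMap {κ : Type*} [Fintype κ] (b : Module.Basis κ L E) (φ : L →ₗ[F] L) :
    E →ₗ[F] E :=
  ∑ k, (LinearMap.toSpanSingleton L E (b k)).restrictScalars F ∘ₗ φ ∘ₗ
    (b.coord k).restrictScalars F

theorem coordMap_smul_basis {κ : Type*} [Fintype κ] (b : Module.Basis κ L E) (φ : L →ₗ[F] L)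
    (x : L) (k : κ) : coordMap b φ (x • b k) = φ x • b k := by
  classical
  simp only [coordMap, LinearMap.sum_apply, LinearMap.comp_apply, LinearMap.restrictScalars_apply,
    Module.Basis.coord_apply, map_smul, Module.Basis.repr_self, LinearMap.toSpanSingleton_apply,
    Finsupp.single_apply, smul_eq_mul]
  rw [Finset.sum_eq_single k]
  · simp
  · intro l _ hl
    simp [hl.symm]
  · simp

/-- On the `F`-span of the `x bᵢ`, the map `coordMap b φ` is multiplication by `φ(x) / x`. -/
theorem card_le_finrank_ker_coordMap_sub [FiniteDimensional F E] {κ : Type*} [Fintype κ]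
    (b : Module.Basis κ L E) (φ : L →ₗ[F] L) {x : L} (hx : x ≠ 0) :
    Fintype.card κ ≤ Module.finrank F
      (LinearMap.ker (coordMap b φ - LinearMap.mulLeft F (algebraMap L E (φ x / x)))) := by
  have hmem : ∀ k, x • b k ∈
      LinearMap.ker (coordMap b φ - LinearMap.mulLeft F (algebraMap L E (φ x / x))) := by
    intro k
    rw [LinearMap.mem_ker, LinearMap.sub_apply, coordMap_smul_basis, LinearMap.mulLeft_apply,
      ← Algebra.smul_def, smul_smul, div_mul_cancel₀ _ hx, sub_self]
  have hL : LinearIndependent L fun k => x • b k :=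
    b.linearIndependent.units_smul fun _ => Units.mk0 x hx
  have hF : LinearIndependent F fun k => x • b k :=
    hL.restrict_scalars' F
  have hker : LinearIndependent F fun k =>
      (⟨x • b k, hmem k⟩ : LinearMap.ker
        (coordMap b φ - LinearMap.mulLeft F (algebraMap L E (φ x / x)))) :=
    LinearIndependent.of_comp (Submodule.subtype _) hF
  exact hker.fintype_card_le_finrank

/-- In an extension of degree `r` of a field with `q` elements, there are at least `q ^ (r - 1)`
powers `x ^ (q - 1)` with `x ≠ 0`. -/
theorem card_pow_le_card_image_frobenius_div [Fintype L] [DecidableEq L] [Finite F] :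
    Nat.card F ^ (Module.finrank F L - 1) ≤
      ((Finset.univ.filter fun x : L => x ≠ 0).image fun x => x ^ Nat.card F / x).card := by
  set q := Nat.card F with hq
  have hq1 : 1 < q := Finite.one_lt_card
  have hr : 0 < Module.finrank F L := Module.finrank_pos
  set S := (Finset.univ.filter fun x : L => x ≠ 0).image fun x => x ^ q / x
  have hcard : (Finset.univ.filter fun x : L => x ≠ 0).card = q ^ Module.finrank F L - 1 := by
    rw [Finset.filter_ne', Finset.card_erase_of_mem (Finset.mem_univ _), Finset.card_univ,
      ← Nat.card_eq_fintype_card, Module.natCard_eq_pow_finrank (K := F)]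
  have hle : (Finset.univ.filter fun x : L => x ≠ 0).card ≤ (q - 1) * S.card := by
    -- A fibre of `x ↦ x^{q-1}` consists of roots of `X^{q-1} = a`, so it has at most `q - 1`
    -- elements.
    refine Finset.card_le_mul_card_image _ _ fun a _ => ?_
    calc _ ≤ (Polynomial.nthRoots (q - 1) a).toFinset.card := by
          refine Finset.card_le_card fun x hx => ?_
          simp only [Finset.mem_filter, Finset.mem_univ, true_and] at hx
          rw [Multiset.mem_toFinset, Polynomial.mem_nthRoots (by omega), ← hx.2,
            eq_div_iff hx.1, ← pow_succ, Nat.sub_add_cancel hq1.le]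
      _ ≤ q - 1 := (Multiset.toFinset_card_le _).trans (Polynomial.card_nthRoots _ _)
  rw [hcard] at hle
  by_contra! hlt
  have h1 : (q - 1) * S.card ≤ (q - 1) * (q ^ (Module.finrank F L - 1) - 1) :=
    Nat.mul_le_mul_left _ (by omega)
  have h2 : q ^ Module.finrank F L = q * q ^ (Module.finrank F L - 1) := by
    rw [← pow_succ', Nat.sub_add_cancel hr]
  -- Writing `q = e + 2` and `q^{r-1} = c + 1` removes truncated subtraction and leaves `(e + 1) *
  -- c` as the only nonlinear term for `omega`.
  obtain ⟨c, hc⟩ : ∃ c, q ^ (Module.finrank F L - 1) = c + 1 :=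
    ⟨_, (Nat.sub_add_cancel (Nat.pos_of_ne_zero (by positivity))).symm⟩
  obtain ⟨e, he⟩ : ∃ e, q = e + 2 := ⟨q - 2, by omega⟩
  have h3 := hle.trans h1
  rw [h2, hc, he] at h3
  have h4 : (e + 2) * (c + 1) = (e + 1) * c + e + c + 2 := by ring
  have h5 : (e + 2 - 1) * (c + 1 - 1) = (e + 1) * c := by simp
  omega

/-- If `E` has degree `r * s` over the field `F` with `q` elements, then some `F`-linear map
`E → E` agrees with at least `q ^ (r - 1)` multiplications on subspaces of dimension `s`. -/
theorem exists_linearMap_many_multipliers [Finite E] {r s : ℕ} (hr : 0 < r)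
    (hrs : Module.finrank F E = r * s) :
    ∃ (w : E →ₗ[F] E) (S : Finset E), Nat.card F ^ (r - 1) ≤ S.card ∧
      ∀ a ∈ S, s ≤ Module.finrank F (LinearMap.ker (w - LinearMap.mulLeft F a)) := by
  classical
  have : Finite F := Finite.of_injective _ (algebraMap F E).injective
  have : Fintype F := Fintype.ofFinite F
  obtain ⟨p, hp⟩ := CharP.exists F
  have : Fact p.Prime := ⟨CharP.char_is_prime F p⟩
  have : NeZero r := ⟨hr.ne'⟩
  have hL : Module.finrank F (FiniteField.Extension F p r) = r := FiniteField.finrank_extension F p r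
  have : Fintype (FiniteField.Extension F p r) := Fintype.ofFinite _
  obtain ⟨f⟩ := FiniteField.nonempty_algHom_of_finrank_dvd
    (F := F) (K := FiniteField.Extension F p r) (L := E) (by rw [hL, hrs]; exact dvd_mul_right _ _)
  -- The field of degree `r` embeds in `E` because `r ∣ r * s`; over it `E` has degree `s`.
  let : Algebra (FiniteField.Extension F p r) E := f.toRingHom.toAlgebra
  have : IsScalarTower F (FiniteField.Extension F p r) E :=
    IsScalarTower.of_algebraMap_eq fun x => (f.commutes x).symm
  have hs : Module.finrank (FiniteField.Extension F p r) E = s := by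
    have h := Module.finrank_mul_finrank F (FiniteField.Extension F p r) E
    rw [hL, hrs] at h
    exact Nat.eq_of_mul_eq_mul_left hr h
  have b := Module.finBasis (FiniteField.Extension F p r) E
  refine ⟨coordMap b (FiniteField.frobeniusAlgHom F _).toLinearMap,
    ((Finset.univ.filter fun x : FiniteField.Extension F p r => x ≠ 0).image
      fun x => x ^ Nat.card F / x).image (algebraMap _ E), ?_, ?_⟩
  · rw [Finset.card_image_of_injective _ (algebraMap (FiniteField.Extension F p r) E).injective]
    conv_lhs => rw [← hL]
    exact card_pow_le_card_image_frobenius_div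
  · intro a ha
    simp only [Finset.mem_image, Finset.mem_filter, Finset.mem_univ, true_and] at ha
    obtain ⟨_, ⟨x, hx, rfl⟩, rfl⟩ := ha
    rw [Nat.card_eq_fintype_card]
    exact ((Fintype.card_fin _).trans hs).symm.le.trans
      (card_le_finrank_ker_coordMap_sub b (FiniteField.frobeniusAlgHom F _).toLinearMap hx)

end Multipliers

/-! ### Many codewords in a ball -/

theorem rankWeight_le_of_mem_range {F K V : Type*} [Field F] [Field K] [Algebra F K]
    [AddCommGroup V] [Module F V] [FiniteDimensional F V] {n : ℕ} (g : V →ₗ[F] K) (v : Fin n → K)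
    (hv : ∀ l, v l ∈ LinearMap.range g) : rankWeight F v ≤ Module.finrank F (LinearMap.range g) :=
  Submodule.finrank_mono (Submodule.span_le.2 (Set.range_subset_iff.2 hv))

theorem finrank_range_comp_le {F V W U : Type*} [Field F] [AddCommGroup V] [Module F V]
    [AddCommGroup W] [Module F W] [AddCommGroup U] [Module F U] [FiniteDimensional F W]
    (f : V →ₗ[F] W) (g : W →ₗ[F] U) :
    Module.finrank F (LinearMap.range (g ∘ₗ f)) ≤ Module.finrank F (LinearMap.range f) := by
  rw [LinearMap.range_comp]
  exact Submodule.finrank_map_le g _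

theorem sigmaPower_gabidulin_mulLeft_mem {F K : Type*} [Field F] [Field K] [Algebra F K]
    (σ : K ≃ₐ[F] K) (E : IntermediateField F K) (j : ℕ) (a : E) :
    (σ ^ j).toLinearMap ∘ₗ LinearMap.mulLeft F (a : K) ∈ sigmaPower σ j (gabidulin σ E 2) := by
  refine ⟨_, ⟨![(a : K), 0], ?_, ?_⟩, rfl⟩
  · intro i
    fin_cases i
    · exact a.2
    · exact E.zero_mem
  · ext x
    simp [sigmaPoly, Fin.sum_univ_two]

/-- If the evaluation points span `β E` with `E` of degree `n = r * s` over the field with `q`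
elements, and the code contains the Gabidulin code of dimension `2`, then some ball of radius
`n - s` contains at least `q ^ (r - 1)` codewords. -/
theorem exists_ball_many_codewords {F K : Type*} [Field F] [Field K] [Finite K] [Algebra F K]
    {n r s : ℕ} (hr : 0 < r) (hs : 0 < s) (hn : n = r * s) (E : IntermediateField F K)
    (hE : Module.finrank F E = n) (σ : K ≃ₐ[F] K) {β : K} {α : Fin n → K}
    (hα : IsBasisOfMul β E α) (𝒞 : Set (K →ₗ[F] K)) (j : ℕ)
    (h𝒞 : sigmaPower σ j (gabidulin σ E 2) ⊆ 𝒞) :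
    ∃ (w : Fin n → K) (T : Finset (Fin n → K)), Nat.card F ^ (r - 1) ≤ T.card ∧
      ∀ c ∈ T, c ∈ evalCode 𝒞 α ∩ ball F (n - s) w := by
  classical
  obtain ⟨w, S, hS, hker⟩ := exists_linearMap_many_multipliers (F := F) (E := E) hr (hE.trans hn)
  have hmem : ∀ l, ∃ x : E, α l = β * x := by
    intro l
    have h : α l ∈ (Submodule.span F (Set.range α) : Set K) :=
      Submodule.subset_span (Set.mem_range_self l)
    rw [hα.2] at h
    obtain ⟨x, hx, h⟩ := h
    exact ⟨⟨x, hx⟩, h⟩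
  choose x hx using hmem
  -- With `α l = β * x l`, the codeword of `a` has entries `emb (a * x l)`. So the rank of its
  -- difference from `emb (w (x l))` is controlled by a map on `E`.
  let emb : E →ₗ[F] K := (σ ^ j).toLinearMap ∘ₗ LinearMap.mulLeft F β ∘ₗ E.val.toLinearMap
  let cw : E → Fin n → K := fun a l => (σ ^ j) ((a : K) * α l)
  have hcw : Function.Injective cw := by
    intro a b hab
    have hn0 : 0 < n := hn ▸ Nat.mul_pos hr hs
    have h := congrFun hab ⟨0, hn0⟩
    exact Subtype.ext (mul_right_cancel₀ (hα.1.ne_zero ⟨0, hn0⟩) ((σ ^ j).injective h))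
  refine ⟨fun l => emb (w (x l)), S.image cw, ?_, ?_⟩
  · rwa [Finset.card_image_of_injective _ hcw]
  · intro c hc
    obtain ⟨a, ha, rfl⟩ := Finset.mem_image.1 hc
    refine ⟨⟨_, h𝒞 (sigmaPower_gabidulin_mulLeft_mem σ E j a), rfl⟩, ?_⟩
    have hrank := LinearMap.finrank_range_add_finrank_ker (w - LinearMap.mulLeft F a)
    rw [hE] at hrank
    have hka := hker a ha
    calc rankWeight F ((fun l => emb (w (x l))) - cw a)
        ≤ Module.finrank F (LinearMap.range (emb ∘ₗ (w - LinearMap.mulLeft F a))) := by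
          refine rankWeight_le_of_mem_range _ _ fun l => ⟨x l, ?_⟩
          have hl : (β : K) * ((a : K) * (x l : K)) = (a : K) * α l := by
            rw [hx l]
            ring
          simp only [LinearMap.comp_apply, LinearMap.sub_apply, map_sub, Pi.sub_apply, cw]
          congr 1
          simp [emb, ← hl]
      _ ≤ Module.finrank F (LinearMap.range (w - LinearMap.mulLeft F a)) :=
          finrank_range_comp_le _ _
      _ ≤ n - s := by omega

/-! ### Output length and running time -/

theorem Machine.length_output_run_le (M : Machine) (input : List Symb) (T : ℕ) :
    (M.run input T).output.length ≤ T := by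
  induction T with
  | zero => simp [Machine.run, Machine.init]
  | succ T ih =>
    have hrun : M.run input (T + 1) = (M.step (M.run input T)).getD (M.run input T) :=
      Function.iterate_succ_apply' _ _ _
    rw [hrun, Machine.step]
    cases M.trans (M.run input T).state fun k => ((M.run input T).tapes k).head with
    | none => exact ih.trans T.le_succ
    | some a =>
      have hlen : a.2.2.toList.length ≤ 1 := by
        cases a.2.2 <;> simp
      simpa using add_le_add ih hlen

/-- Every listed word contributes its closing semicolon, however short the encodings of its entries
are. -/
theorem length_le_length_encodeList {K : Type*} (enc : K → List Bool) {n : ℕ}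
    (L : List (Fin n → K)) : L.length ≤ (encodeList enc L).length := by
  induction L with
  | nil => simp
  | cons c L ih =>
    have h : encodeList enc (c :: L) = encodeWord enc c ++ [Symb.semicolon] ++ encodeList enc L := by
      simp [encodeList]
    rw [h, List.length_append, List.length_append, List.length_cons, List.length_singleton]
    omega

/-- An efficient list decoder only copes with lists of polynomial size. -/
theorem EfficientlyListDecodable.exists_card_le {ι : Type*} {F K : ι → Type*}
    [∀ i, Field (F i)] [∀ i, Field (K i)] [∀ i, Algebra (F i) (K i)] {n : ι → ℕ}
    {C : ∀ i, Set (Fin (n i) → K i)} {τ : ι → ℕ} (h : EfficientlyListDecodable F C τ) :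
    ∃ p : Polynomial ℕ, ∀ (i : ι) (w : Fin (n i) → K i) (T : Finset (Fin (n i) → K i)),
      (∀ c ∈ T, c ∈ C i ∩ ball (F i) (τ i) w) → T.card ≤ p.eval (n i) := by
  classical
  obtain ⟨M, desc, enc, p, -, h⟩ := h
  refine ⟨p, fun i w T hT => ?_⟩
  obtain ⟨L, hL, -, hout⟩ := h i w
  calc T.card ≤ L.toFinset.card :=
        Finset.card_le_card fun c hc => List.mem_toFinset.2 ((hL c).2 (hT c hc))
    _ ≤ L.length := L.toFinset_card_le
    _ ≤ (encodeList (enc i) L).length := length_le_length_encodeList _ _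
    _ ≤ p.eval (n i) := hout ▸ M.length_output_run_le _ _

theorem eventually_eval_lt_two_pow (p : Polynomial ℕ) :
    ∀ᶠ t : ℕ in Filter.atTop, p.eval t < 2 ^ t := by
  have h : (fun t : ℕ => ((p.eval t : ℕ) : ℝ)) =o[Filter.atTop] fun t : ℕ => (2 : ℝ) ^ t := by
    simp only [Polynomial.eval_eq_sum_range, Nat.cast_sum, Nat.cast_mul, Nat.cast_pow]
    have hterm : ∀ k ∈ Finset.range (p.natDegree + 1),
        (fun t : ℕ => (p.coeff k : ℝ) * (t : ℝ) ^ k) =o[Filter.atTop] fun t : ℕ => (2 : ℝ) ^ t :=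
      fun k _ => (isLittleO_pow_const_const_pow_of_one_lt k one_lt_two).const_mul_left _
    exact Asymptotics.IsLittleO.fun_sum hterm
  -- The constant `1 / 2` makes the final inequality strict, as `2 ^ t > 0`.
  filter_upwards [h.bound (show (0 : ℝ) < 1 / 2 by norm_num)] with t ht
  rw [Real.norm_of_nonneg (by positivity), Real.norm_of_nonneg (by positivity)] at ht
  have hpos : (0 : ℝ) < 2 ^ t := by positivity
  have hlt : ((p.eval t : ℕ) : ℝ) < 2 ^ t := by linarith
  exact_mod_cast hlt

end RankMetric

/-- For each index `i`: `F i` is `𝔽_q`, `K i` is `𝔽_{q^m}` and `E i` is its subfield `𝔽_{q^n}`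
(so that `n ∣ m`), and `σ i` generates the Galois group of `K i` over `F i`. -/
theorem mainTheorem9 {ι : Type*} (F K : ι → Type*)
    [∀ i, Field (F i)] [∀ i, Field (K i)] [∀ i, Finite (K i)] [∀ i, Algebra (F i) (K i)]
    (n m t d j : ι → ℕ)
    (E : ∀ i, IntermediateField (F i) (K i))
    (σ : ∀ i, K i ≃ₐ[F i] K i)
    (β : ∀ i, K i)
    (α : ∀ i, Fin (n i) → K i)
    (𝒞 : ∀ i, Set (K i →ₗ[F i] K i))
    (hq : ∀ i, ∃ e : ℕ, Nat.card (F i) = 2 ^ e)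
    (hm : ∀ i, Module.finrank (F i) (K i) = m i)
    (hnm : ∀ i, n i ∣ m i)
    (hE : ∀ i, Module.finrank (F i) (E i) = n i)
    (hσ : ∀ i, ∀ g : K i ≃ₐ[F i] K i, g ∈ Subgroup.zpowers (σ i))
    (hβ : ∀ i, β i ≠ 0)
    (hα : ∀ i, RankMetric.IsBasisOfMul (β i) (E i) (α i))
    (hd : ∀ i, RankMetric.IsMinDist (F i) (RankMetric.evalCode (𝒞 i) (α i)) (d i))
    (ht : ∀ i, ∃ e : ℕ, t i = 2 ^ e)
    (hn : ∀ i, n i = t i ^ 2 - 1)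
    (ht_lower : ∀ i, (n i : ℤ) - d i + 1 ≤ t i)
    (ht_upper : ∀ i, (t i : ℤ) ≤ n i - ((d i : ℤ) - 1) / 2 - 1)
    (hj : ∀ i, (j i : ℤ) < n i - t i)
    (h𝒞 : ∀ i, RankMetric.sigmaPower (σ i) (j i) (RankMetric.gabidulin (σ i) (E i) 2) ⊆ 𝒞 i)
    (h_unbounded : ∀ N : ℕ, ∃ i, N ≤ n i)
    (τ : ι → ℕ) (hτ : ∀ i, (n i : ℤ) - t i ≤ τ i) :
    ¬ RankMetric.EfficientlyListDecodable F
        (fun i => RankMetric.evalCode (𝒞 i) (α i)) τ := by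
  intro hdec
  obtain ⟨p, hp⟩ := hdec.exists_card_le
  -- `X ^ 2` accounts for `n ≤ t²`, and the factor `4` for the list size `2 ^ (t - 2)`.
  obtain ⟨N, hN⟩ := Filter.eventually_atTop.1
    (RankMetric.eventually_eval_lt_two_pow (4 * p.comp (Polynomial.X ^ 2)))
  obtain ⟨i, hi⟩ := h_unbounded (N ^ 2 + 1)
  have hni := hn i
  have hNt : N < t i := lt_of_pow_lt_pow_left₀ 2 (Nat.zero_le _) (by omega)
  -- The values `t = 0, 1` would give `n = 0`, against `N ^ 2 + 1 ≤ n`.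
  obtain ⟨s, hs⟩ : ∃ s, t i = s + 2 := by
    refine ⟨t i - 2, (Nat.sub_add_cancel ?_).symm⟩
    by_contra! hlt
    interval_cases t i <;> omega
  have hfac : n i = (s + 1) * (s + 3) := by
    rw [hni, hs, show (s + 2) ^ 2 = (s + 1) * (s + 3) + 1 by ring, Nat.add_sub_cancel]
  -- The subfield degree is `s + 1 = t - 1` and the agreement dimension `s + 3 = t + 1`; the radius
  -- `n - (t + 1)` lies below `τ`.
  obtain ⟨w, T, hT, hmem⟩ := RankMetric.exists_ball_many_codewords s.succ_pos (s + 2).succ_pos hfac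
    (E i) (hE i) (σ i) (hα i) (𝒞 i) (j i) (h𝒞 i)
  have hτi := hτ i
  have hcard : T.card ≤ p.eval (n i) :=
    hp i w T fun c hc => ⟨(hmem c hc).1,
      show RankMetric.rankDist (F i) w c ≤ τ i from le_trans (hmem c hc).2 (by omega)⟩
  have hF : 2 ≤ Nat.card (F i) := by
    have : Finite (F i) := Finite.of_injective _ (algebraMap (F i) (K i)).injective
    exact Finite.one_lt_card
  have hlow : 2 ^ s ≤ T.card := (Nat.pow_le_pow_left hF s).trans hT
  have hmono : p.eval (n i) ≤ p.eval (t i ^ 2) := by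
    simp only [Polynomial.eval_eq_sum_range]
    gcongr
    omega
  have hP := hN (t i) hNt.le
  have heval : (4 * p.comp (Polynomial.X ^ 2)).eval (t i) = 4 * p.eval (t i ^ 2) := by
    simp [Polynomial.eval_comp]
  rw [heval] at hP
  have hpow : 2 ^ t i = 4 * 2 ^ s := by
    rw [hs, pow_add]
    ring
  omega
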